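/- Let $\mathbb{F}$ be an infinite field of arbitrary characteristic. Let $\mathsf{A}_1=\mathbb{F}\langle x,y\rangle/(yx-xy-1)$ be the first Weyl algebra, $\mathsf{V}=\mathbb{F}\text{-span}\{x,y\}\subset\mathsf{A}_1$, and let $\mathbb{F}\langle X\rangle$ be the free unital associative $\mathbb{F}$-algebra on the letters $x_1,x_2,\dots$. An element $f(x_1,\dots,x_m)\in\mathbb{F}\langle X\rangle$ is called a weak polynomial identity for the pair $(\mathsf{A}_1,\mathsf{V})$ if $f(a_1,\dots,a_m)=0$ in $\mathsf{A}_1$ for all $a_1,\dots,a_m\in\mathsf{V}$. With $[a,b]=ab-ba$, put $$\Gamma_3(x_1,x_2,x_3)=[[x_1,x_2],x_3],\qquad \mathrm{St}_3(x_1,x_2,x_3)=x_1[x_2,x_3]-x_2[x_1,x_3]+x_3[x_1,x_2],$$ $$T_4(x_1,x_2,x_3,x_4)=[x_1,x_2][x_3,x_4]-[x_1,x_3][x_2,x_4]+[x_2,x_3][x_1,x_4].$$ Let $\mathcal{I}$ be the L-ideal of $\mathbb{F}\langle X\rangle$ generated by $\Gamma_3$, $\mathrm{St}_3$ and $T_4$,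 that is, the $\mathbb{F}$-span of all elements $u\,h(g_1,\dots,g_m)\,v$, where $h\in\{\Gamma_3,\mathrm{St}_3,T_4\}$ has $m$ variables, $u,v\in\mathbb{F}\langle X\rangle$, and $g_1,\dots,g_m$ are $\mathbb{F}$-linear combinations of letters. Then every weak polynomial identity for $(\mathsf{A}_1,\mathsf{V})$ in two variables lies in $\mathcal{I}$: if $i,j\ge 1$ and $f\in\mathbb{F}\langle x_i,x_j\rangle\subset\mathbb{F}\langle X\rangle$ is a weak polynomial identity for $(\mathsf{A}_1,\mathsf{V})$, then $f\in\mathcal{I}$. -/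

import Mathlib

namespace WeakIdentities

/-- The relation `y * x ∼ x * y + 1` on the free unital algebra on two letters
`x = ι 0` and `y = ι 1`. -/
inductive WeylRel (F : Type*) [Field F] :
    FreeAlgebra F (Fin 2) → FreeAlgebra F (Fin 2) → Prop
  | mk : WeylRel F (FreeAlgebra.ι F 1 * FreeAlgebra.ι F 0)
      (FreeAlgebra.ι F 0 * FreeAlgebra.ι F 1 + 1)

/-- The first Weyl algebra `F⟨x, y⟩ / (y x - x y - 1)`. -/
abbrev Weyl (F : Type*) [Field F] : Type _ := RingQuot (WeylRel F)

/-- The generator `x` of the Weyl algebra. -/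
noncomputable def Weyl.x (F : Type*) [Field F] : Weyl F :=
  RingQuot.mkAlgHom F (WeylRel F) (FreeAlgebra.ι F 0)

/-- The generator `y` of the Weyl algebra. -/
noncomputable def Weyl.y (F : Type*) [Field F] : Weyl F :=
  RingQuot.mkAlgHom F (WeylRel F) (FreeAlgebra.ι F 1)

/-- The subspace `V = span {x, y}` of the Weyl algebra. -/
noncomputable def Weyl.V (F : Type*) [Field F] : Submodule F (Weyl F) :=
  Submodule.span F {Weyl.x F, Weyl.y F}

theorem Weyl.y_mul_x (F : Type*) [Field F] :
    Weyl.y F * Weyl.x F = Weyl.x F * Weyl.y F + 1 := by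
  simpa [Weyl.x, Weyl.y] using RingQuot.mkAlgHom_rel F (WeylRel.mk (F := F))

/-- `V` generates the Weyl algebra: every element is a noncommutative polynomial without
free term in elements of `V`. So the identities of `V` are the weak identities of the pair
consisting of the Weyl algebra and `V`. -/
theorem Weyl.adjoin_V (F : Type*) [Field F] :
    NonUnitalAlgebra.adjoin F (Weyl.V F : Set (Weyl F)) = ⊤ := by
  set B := NonUnitalAlgebra.adjoin F (Weyl.V F : Set (Weyl F)) with hB
  have hx : Weyl.x F ∈ B :=
    NonUnitalAlgebra.subset_adjoin F (Submodule.subset_span (by simp))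
  have hy : Weyl.y F ∈ B :=
    NonUnitalAlgebra.subset_adjoin F (Submodule.subset_span (by simp))
  have h1 : (1 : Weyl F) ∈ B := by
    have h : (1 : Weyl F) = Weyl.y F * Weyl.x F - Weyl.x F * Weyl.y F := by
      rw [Weyl.y_mul_x]; abel
    rw [h]
    exact sub_mem (mul_mem hy hx) (mul_mem hx hy)
  rw [eq_top_iff]
  rintro a -
  obtain ⟨p, rfl⟩ := RingQuot.mkAlgHom_surjective F (WeylRel F) a
  induction p using FreeAlgebra.induction with
  | grade0 r =>
    rw [AlgHom.commutes, Algebra.algebraMap_eq_smul_one]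
    exact B.smul_mem r h1
  | grade1 i =>
    fin_cases i
    · exact hx
    · exact hy
  | mul p q hp hq => rw [map_mul]; exact mul_mem hp hq
  | add p q hp hq => rw [map_add]; exact add_mem hp hq

/-- The free unital algebra `F⟨X⟩` on countably many letters; the letters are
`ι 0, ι 1, ι 2, …`. -/
abbrev FreeAlg (F : Type*) [Field F] : Type _ := FreeAlgebra F ℕ

/-- `f` is a polynomial identity for the subspace `V` of the unital algebra `A`: it vanishes
whenever elements of `V` are substituted for its letters. -/
def IsIdentityOn {F : Type*} [Field F] {A : Type*} [Ring A] [Algebra F A]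
    (V : Submodule F A) (f : FreeAlg F) : Prop :=
  ∀ a : ℕ → A, (∀ k, a k ∈ V) → FreeAlgebra.lift F a f = 0

/-- The L-ideal generated by a set `S`: the linear span of all `u * s(g₀, g₁, …) * v` with
`s ∈ S`, `u v` arbitrary, and every `g k` a linear combination of letters. -/
def LIdealSpan {F : Type*} [Field F] (S : Set (FreeAlg F)) : Submodule F (FreeAlg F) :=
  Submodule.span F {h | ∃ s ∈ S, ∃ g : ℕ → FreeAlg F,
    (∀ k, g k ∈ Submodule.span F (Set.range (FreeAlgebra.ι F : ℕ → FreeAlg F))) ∧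
      ∃ u v : FreeAlg F, h = u * FreeAlgebra.lift F g s * v}

/-- `[[a, b], c]`, where `⁅a, b⁆ = a * b - b * a`. -/
def gamma3 {R : Type*} [Ring R] (a b c : R) : R := ⁅⁅a, b⁆, c⁆

/-- `a [b, c] - b [a, c] + c [a, b]`. -/
def st3 {R : Type*} [Ring R] (a b c : R) : R := a * ⁅b, c⁆ - b * ⁅a, c⁆ + c * ⁅a, b⁆

/-- `[a, b] [c, d] - [a, c] [b, d] + [b, c] [a, d]`. -/
def t4 {R : Type*} [Ring R] (a b c d : R) : R :=
  ⁅a, b⁆ * ⁅c, d⁆ - ⁅a, c⁆ * ⁅b, d⁆ + ⁅b, c⁆ * ⁅a, d⁆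

/-- The L-ideal generated by the elements `Γ₃`, `St₃` and `T₄` of `F⟨X⟩`. -/
noncomputable def idealI (F : Type*) [Field F] : Submodule F (FreeAlg F) :=
  LIdealSpan {gamma3 (FreeAlgebra.ι F 0) (FreeAlgebra.ι F 1) (FreeAlgebra.ι F 2),
    st3 (FreeAlgebra.ι F 0) (FreeAlgebra.ι F 1) (FreeAlgebra.ι F 2),
    t4 (FreeAlgebra.ι F 0) (FreeAlgebra.ι F 1) (FreeAlgebra.ι F 2) (FreeAlgebra.ι F 3)}

end WeakIdentities

/-! Write a, b for the two letters and c = [a, b]. Modulo Γ₃ the element c commutes with a and b, so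
f reduces to a combination P of the monomials a^p b^q c^r (`exists_normalForm_sub_mem`).
Substituting a = s x, b = y makes c the scalar -s, and such a monomial becomes s^p (-s)^r x^p y^q.
The x^p y^q are linearly independent in the Weyl algebra, and over an infinite field the powers of s
separate the exponents r. An identity therefore forces P = 0 (`Weyl.eq_zero_of_normalForm_eq_zero`),
which puts f in the ideal. -/

namespace WeakIdentities

open Polynomial

/-! ### Normal forms modulo a central commutator. -/

section NormalForm

variable {F A : Type*} [Field F] [Ring A] [Algebra F A]

/-- In a ring where `c = [a, b]` commutes with `a`, the powers of `a` satisfy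
`b a ^ p = a ^ p b - p a ^ (p - 1) c`. -/
theorem mul_pow_of_commute {R : Type*} [Ring R] {a b : R} (hca : Commute ⁅a, b⁆ a) (p : ℕ) :
    b * a ^ p = a ^ p * b - p • (a ^ (p - 1) * ⁅a, b⁆) := by
  have hba : b * a = a * b - ⁅a, b⁆ := by rw [Ring.lie_def]; abel
  induction p with
  | zero => simp
  | succ p ih =>
    have hc : a ^ p * ⁅a, b⁆ = ⁅a, b⁆ * a ^ p := (hca.pow_right p).eq.symm
    have h1 : (p • (a ^ (p - 1) * ⁅a, b⁆)) * a = p • (a ^ p * ⁅a, b⁆) := by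
      rcases p with _ | p
      · simp
      · rw [smul_mul_assoc, mul_assoc, hca.eq, ← mul_assoc, Nat.add_sub_cancel, ← pow_succ]
    rw [pow_succ, ← mul_assoc, ih, sub_mul, h1, mul_assoc, hba, Nat.add_sub_cancel, succ_nsmul,
      mul_sub, ← mul_assoc]
    abel

theorem mul_normalMonomial {R : Type*} [Ring R] {a b : R} (hca : Commute ⁅a, b⁆ a)
    (hcb : Commute ⁅a, b⁆ b) (p q r : ℕ) :
    b * (a ^ p * b ^ q * ⁅a, b⁆ ^ r) =
      a ^ p * b ^ (q + 1) * ⁅a, b⁆ ^ r - p • (a ^ (p - 1) * b ^ q * ⁅a, b⁆ ^ (r + 1)) := by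
  have hc : ⁅a, b⁆ * b ^ q = b ^ q * ⁅a, b⁆ := (hcb.pow_right q).eq
  rw [← mul_assoc, ← mul_assoc, mul_pow_of_commute hca, sub_mul, sub_mul, smul_mul_assoc,
    smul_mul_assoc, mul_assoc (a ^ (p - 1)), hc, mul_assoc (a ^ p) b, ← pow_succ',
    pow_succ' ⁅a, b⁆ r]
  simp only [mul_assoc]

/-- The linear map sending the basis vector `(p, q, r)` to `a ^ p b ^ q [a, b] ^ r`. -/
noncomputable def normalForm (F : Type*) {A : Type*} [Field F] [Ring A] [Algebra F A] (a b : A) :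
    (ℕ × ℕ × ℕ →₀ F) →ₗ[F] A :=
  Finsupp.linearCombination F fun n => a ^ n.1 * b ^ n.2.1 * ⁅a, b⁆ ^ n.2.2

theorem normalMonomial_mem_range (a b : A) (p q r : ℕ) :
    a ^ p * b ^ q * ⁅a, b⁆ ^ r ∈ LinearMap.range (normalForm F a b) :=
  ⟨Finsupp.single (p, q, r) 1, by simp [normalForm]⟩

/-- Modulo a two-sided ideal containing `[[a, b], a]` and `[[a, b], b]`, the algebra generated by
`a` and `b` is spanned by the elements `a ^ p b ^ q [a, b] ^ r`. -/
theorem exists_normalForm_sub_mem {a b : A} (J : TwoSidedIdeal A)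
    (ha : ⁅⁅a, b⁆, a⁆ ∈ J) (hb : ⁅⁅a, b⁆, b⁆ ∈ J) {f : A}
    (hf : f ∈ Algebra.adjoin F ({a, b} : Set A)) :
    ∃ P, f - normalForm F a b P ∈ J := by
  -- Left multiplication by the subalgebra preserves normal forms modulo `J`; applying this to the
  -- normal form 1 gives the claim.
  have key : ∀ x ∈ Algebra.adjoin F ({a, b} : Set A), ∀ P : ℕ × ℕ × ℕ →₀ F,
      ∃ Q, x * normalForm F a b P - normalForm F a b Q ∈ J := by
    intro x hx
    induction hx using Algebra.adjoin_induction with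
    | algebraMap c =>
      intro P
      exact ⟨c • P, by simp [Algebra.smul_def, J.zero_mem]⟩
    | add x y _ _ hx hy =>
      intro P
      obtain ⟨Q, hQ⟩ := hx P
      obtain ⟨R, hR⟩ := hy P
      refine ⟨Q + R, ?_⟩
      rw [map_add, add_mul, add_sub_add_comm]
      exact J.add_mem hQ hR
    | mul x y _ _ hx hy =>
      intro P
      obtain ⟨Q, hQ⟩ := hy P
      obtain ⟨R, hR⟩ := hx Q
      refine ⟨R, ?_⟩
      have h := J.add_mem (J.mul_mem_left x _ hQ) hR
      rwa [mul_sub, sub_add_sub_cancel, ← mul_assoc] at h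
    | mem x hx =>
      intro P
      induction P using Finsupp.induction_linear with
      | zero => exact ⟨0, by simp [J.zero_mem]⟩
      | add P Q hP hQ =>
        obtain ⟨P', hP⟩ := hP
        obtain ⟨Q', hQ⟩ := hQ
        refine ⟨P' + Q', ?_⟩
        rw [map_add, map_add, mul_add, add_sub_add_comm]
        exact J.add_mem hP hQ
      | single n c =>
        obtain ⟨p, q, r⟩ := n
        suffices h : ∃ Q, x * (a ^ p * b ^ q * ⁅a, b⁆ ^ r) - normalForm F a b Q ∈ J by
          obtain ⟨Q, hQ⟩ := h
          refine ⟨c • Q, ?_⟩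
          have h := J.mul_mem_left (algebraMap F A c) _ hQ
          rw [← Algebra.smul_def, smul_sub, ← mul_smul_comm] at h
          simpa [normalForm] using h
        rcases hx with rfl | rfl
        · obtain ⟨Q, hQ⟩ := normalMonomial_mem_range (F := F) x b (p + 1) q r
          refine ⟨Q, ?_⟩
          rw [hQ, pow_succ']
          simp [mul_assoc, J.zero_mem]
        · obtain ⟨Q, hQ⟩ := normalMonomial_mem_range (F := F) a x p (q + 1) r
          obtain ⟨R, hR⟩ := normalMonomial_mem_range (F := F) a x (p - 1) q (r + 1)
          -- At p = 0 the truncated exponent p - 1 is harmless, since its coefficient p vanishes.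
          refine ⟨Q - p • R, ?_⟩
          rw [map_sub, map_nsmul, hQ, hR]
          -- In the quotient by `J` the commutator genuinely commutes with both generators.
          let π := J.ringCon.mk'
          have hπ : ∀ z, π z = 0 ↔ z ∈ J := fun z => by
            rw [TwoSidedIdeal.mem_iff, ← J.ringCon.eq]
            rfl
          have hlie : ∀ u v, π ⁅u, v⁆ = ⁅π u, π v⁆ := fun u v => by
            simp only [Ring.lie_def, map_sub, map_mul]
          have hca : Commute ⁅π a, π x⁆ (π a) := by
            rw [commute_iff_lie_eq, ← hlie, ← hlie, hπ]; exact ha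
          have hcb : Commute ⁅π a, π x⁆ (π x) := by
            rw [commute_iff_lie_eq, ← hlie, ← hlie, hπ]; exact hb
          rw [← hπ]
          simp only [map_sub, map_mul, map_pow, map_nsmul, hlie]
          rw [mul_normalMonomial hca hcb, sub_self]
  obtain ⟨Q, hQ⟩ := key f hf (Finsupp.single (0, 0, 0) 1)
  exact ⟨Q, by simpa [normalForm] using hQ⟩

end NormalForm

/-! ### Independence of monomials in the Weyl algebra. -/

section Weyl

variable (F : Type*) [Field F]

/-- The action of the Weyl algebra on `F[u][t]`: the generator `x` multiplies by `t`, and `y` acts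
as `u + d/dt`. It is faithful in every characteristic. -/
noncomputable def Weyl.rep : Weyl F →ₐ[F] Module.End F F[X][X] :=
  RingQuot.liftAlgHom F ⟨FreeAlgebra.lift F
    ![LinearMap.mulLeft F X, LinearMap.mulLeft F (C X) + derivative.restrictScalars F], by
      rintro _ _ ⟨⟩
      ext1 f
      simp [mul_add]
      ring⟩

theorem Weyl.rep_x (f : F[X][X]) : Weyl.rep F (Weyl.x F) f = X * f := by
  simp [Weyl.rep, Weyl.x]

theorem Weyl.rep_y (f : F[X][X]) : Weyl.rep F (Weyl.y F) f = C X * f + derivative f := by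
  simp [Weyl.rep, Weyl.y]

/-- Distinct x^p y^q send 1 to distinct monomials t^p u^q, hence are independent. The variable u is
essential in characteristic ℓ > 0, where the ℓ-th power of d/dt is zero. -/
theorem Weyl.rep_x_pow_mul_y_pow (p q : ℕ) :
    Weyl.rep F (Weyl.x F ^ p * Weyl.y F ^ q) 1 = monomial p (monomial q 1) := by
  have hy : Weyl.rep F (Weyl.y F ^ q) 1 = C (X ^ q) := by
    induction q with
    | zero => simp
    | succ q ih =>
      rw [pow_succ', map_mul, Module.End.mul_apply, ih, Weyl.rep_y, derivative_C, add_zero,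
        ← C_mul, pow_succ']
  have hx (f : F[X][X]) : Weyl.rep F (Weyl.x F ^ p) f = X ^ p * f := by
    induction p with
    | zero => simp
    | succ p ih =>
      rw [pow_succ', map_mul, Module.End.mul_apply, ih, Weyl.rep_x, pow_succ', mul_assoc]
  rw [map_mul, Module.End.mul_apply, hy, hx, X_pow_mul, C_mul_X_pow_eq_monomial,
    X_pow_eq_monomial]

theorem Weyl.lie_smul_x_y (s : F) : ⁅s • Weyl.x F, Weyl.y F⁆ = algebraMap F (Weyl F) (-s) := by
  rw [Ring.lie_def, smul_mul_assoc, mul_smul_comm, Weyl.y_mul_x, smul_add, sub_add_cancel_left, map_neg,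
    Algebra.algebraMap_eq_smul_one]

variable {F} in
/-- Over an infinite field, a normal form vanishing at all pairs `(s x, y)` is zero. -/
theorem Weyl.eq_zero_of_normalForm_eq_zero [Infinite F] (P : ℕ × ℕ × ℕ →₀ F)
    (h : ∀ s : F, normalForm F (s • Weyl.x F) (Weyl.y F) P = 0) : P = 0 := by
  ext ⟨p, q, r⟩
  -- The coefficient of t^p u^q in the image of 1, as a polynomial in s; its s^(p+r) term isolates P
  -- (p, q, r) up to sign.
  let G : F[X] := P.sum fun n c =>
    if n.1 = p ∧ n.2.1 = q then monomial (n.1 + n.2.2) (c * (-1) ^ n.2.2) else 0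
  have hG : G = 0 := by
    refine Polynomial.funext fun s => ?_
    have h1 := congrArg (fun w => ((Weyl.rep F w 1).coeff p).coeff q) (h s)
    simp only [map_zero, LinearMap.zero_apply, coeff_zero] at h1
    rw [eval_zero, ← h1]
    simp only [G, normalForm, Finsupp.linearCombination_apply, Finsupp.sum, map_sum,
      eval_finsetSum, LinearMap.sum_apply, finsetSum_coeff]
    refine Finset.sum_congr rfl fun n _ => ?_
    have h2 : (s • Weyl.x F) ^ n.1 * Weyl.y F ^ n.2.1 * ⁅s • Weyl.x F, Weyl.y F⁆ ^ n.2.2 =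
        (s ^ n.1 * (-s) ^ n.2.2) • (Weyl.x F ^ n.1 * Weyl.y F ^ n.2.1) := by
      rw [Weyl.lie_smul_x_y, ← map_pow, ← Algebra.commutes, ← Algebra.smul_def, _root_.smul_pow,
        smul_mul_assoc, smul_smul, mul_comm]
    rw [h2, map_smul, map_smul, LinearMap.smul_apply, LinearMap.smul_apply,
      Weyl.rep_x_pow_mul_y_pow, coeff_smul, coeff_smul, coeff_smul, coeff_smul, coeff_monomial]
    by_cases hp : n.1 = p
    · by_cases hq : n.2.1 = q
      · simp only [hp, hq, and_self, if_true, eval_monomial, coeff_monomial, smul_eq_mul]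
        rw [neg_pow s, pow_add]
        ring
      · simp [hp, hq, coeff_monomial]
    · simp [hp]
  have hc := congrArg (fun g => coeff g (p + r)) hG
  simp only [G, Finsupp.sum, finsetSum_coeff, coeff_zero] at hc
  rw [Finset.sum_eq_single (p, q, r)] at hc
  · simpa using hc
  · rintro ⟨p', q', r'⟩ _ hne
    dsimp only
    split_ifs with h'
    · obtain ⟨rfl, rfl⟩ := h'
      rw [coeff_monomial, if_neg]
      intro hr
      exact hne (by rw [Nat.add_left_cancel hr])
    · simp
  · intro hn
    simp [Finsupp.notMem_support_iff.mp hn]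

end Weyl

/-! ### Membership in the L-ideal. -/

section Ideal

variable {F : Type*} [Field F]

/-- An L-ideal, as a two-sided ideal. -/
noncomputable def LIdealSpan.toTwoSidedIdeal (S : Set (FreeAlg F)) :
    TwoSidedIdeal (FreeAlg F) :=
  .mk' (LIdealSpan S : Set (FreeAlg F)) (zero_mem (LIdealSpan S)) (fun hx hy => add_mem hx hy)
    (fun hx => neg_mem hx)
    (fun {w x} hx => by
      change w * x ∈ LIdealSpan S
      refine Submodule.span_induction (p := fun x _ => w * x ∈ LIdealSpan S) ?_ (by simp)
        (fun x y _ _ h h' => by rw [mul_add]; exact add_mem h h')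
        (fun c x _ h => by rw [mul_smul_comm]; exact Submodule.smul_mem _ c h) hx
      rintro _ ⟨s, hs, g, hg, u, v, rfl⟩
      exact Submodule.subset_span ⟨s, hs, g, hg, w * u, v, by simp only [mul_assoc]⟩)
    (fun {x w} hx => by
      change x * w ∈ LIdealSpan S
      refine Submodule.span_induction (p := fun x _ => x * w ∈ LIdealSpan S) ?_ (by simp)
        (fun x y _ _ h h' => by rw [add_mul]; exact add_mem h h')
        (fun c x _ h => by rw [smul_mul_assoc]; exact Submodule.smul_mem _ c h) hx
      rintro _ ⟨s, hs, g, hg, u, v, rfl⟩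
      exact Submodule.subset_span ⟨s, hs, g, hg, u, v * w, by simp only [mul_assoc]⟩)

theorem LIdealSpan.mem_toTwoSidedIdeal {S : Set (FreeAlg F)} {x : FreeAlg F} :
    x ∈ LIdealSpan.toTwoSidedIdeal S ↔ x ∈ LIdealSpan S :=
  TwoSidedIdeal.mem_mk' _ _ _ _ _ _ _

theorem gamma3_letters_mem_idealI (k l m : ℕ) :
    ⁅⁅(FreeAlgebra.ι F k : FreeAlg F), FreeAlgebra.ι F l⁆, FreeAlgebra.ι F m⁆ ∈ idealI F := by
  refine Submodule.subset_span ⟨_, Or.inl rfl,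
    fun n => FreeAlgebra.ι F (if n = 0 then k else if n = 1 then l else m),
    fun n => Submodule.subset_span ⟨_, rfl⟩, 1, 1, ?_⟩
  simp [gamma3, Ring.lie_def]

theorem mem_idealI_of_ne [Infinite F] {i j : ℕ} (hij : i ≠ j) {f : FreeAlg F}
    (hf : f ∈ Algebra.adjoin F ({FreeAlgebra.ι F i, FreeAlgebra.ι F j} : Set (FreeAlg F)))
    (hid : IsIdentityOn (Weyl.V F) f) : f ∈ idealI F := by
  let v : F → ℕ → Weyl F := fun s k => if k = i then s • Weyl.x F else Weyl.y F
  let e : F → FreeAlg F →ₐ[F] Weyl F := fun s => FreeAlgebra.lift F (v s)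
  have hei (s : F) : e s (FreeAlgebra.ι F i) = s • Weyl.x F := by simp [e, v]
  have hej (s : F) : e s (FreeAlgebra.ι F j) = Weyl.y F := by simp [e, v, hij.symm]
  have helie (s : F) (g h : FreeAlg F) : e s ⁅g, h⁆ = ⁅e s g, e s h⁆ := by
    simp only [Ring.lie_def, map_sub, map_mul]
  obtain ⟨S, hS⟩ : ∃ S, idealI F = LIdealSpan S := ⟨_, rfl⟩
  -- Intersecting with the evaluation kernels makes the reduction valid in the ideal and under every
  -- evaluation at once, so only Γ₃ has to be checked to vanish there.
  let J : TwoSidedIdeal (FreeAlg F) :=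
    LIdealSpan.toTwoSidedIdeal S ⊓ ⨅ s, TwoSidedIdeal.ker (e s)
  have hJ {x : FreeAlg F} : x ∈ J ↔ x ∈ idealI F ∧ ∀ s, e s x = 0 := by
    simp only [J, TwoSidedIdeal.mem_inf, TwoSidedIdeal.mem_iInf, TwoSidedIdeal.mem_ker,
      LIdealSpan.mem_toTwoSidedIdeal, hS]
  have hJmem (k : ℕ) :
      ⁅⁅(FreeAlgebra.ι F i : FreeAlg F), FreeAlgebra.ι F j⁆, FreeAlgebra.ι F k⁆ ∈ J := by
    refine hJ.mpr ⟨gamma3_letters_mem_idealI i j k, fun s => ?_⟩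
    rw [helie, helie, hei, hej, Weyl.lie_smul_x_y]
    exact (commute_iff_lie_eq).mp (Algebra.commutes _ _)
  obtain ⟨P, hP⟩ := exists_normalForm_sub_mem J (hJmem i) (hJmem j) hf
  rw [hJ] at hP
  have hP0 : P = 0 := Weyl.eq_zero_of_normalForm_eq_zero P fun s => by
    have hfs : e s f = 0 := hid _ fun k => by
      by_cases hk : k = i
      · simp only [v, hk, if_true]
        exact Submodule.smul_mem _ _ (Submodule.subset_span (by simp))
      · simp only [v, hk, if_false]
        exact Submodule.subset_span (by simp)
    have h := hP.2 s
    rw [map_sub, hfs, zero_sub, neg_eq_zero] at h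
    rw [← h]
    simp [normalForm, Finsupp.linearCombination_apply, Finsupp.sum, helie, hei, hej]
  simpa [hP0] using hP.1

end Ideal

end WeakIdentities

theorem mainTheorem1 (F : Type*) [Field F] [Infinite F] (i j : ℕ)
    (f : WeakIdentities.FreeAlg F)
    (hf : f ∈ Algebra.adjoin F
      ({FreeAlgebra.ι F i, FreeAlgebra.ι F j} : Set (WeakIdentities.FreeAlg F)))
    (hid : WeakIdentities.IsIdentityOn (WeakIdentities.Weyl.V F) f) :
    f ∈ WeakIdentities.idealI F := by
  by_cases hij : i = j
  · subst hij
    -- A polynomial in one letter is treated as one in the letters i and i + 1.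
    refine WeakIdentities.mem_idealI_of_ne (Nat.succ_ne_self i).symm
      (Algebra.adjoin_mono ?_ hf) hid
    simp
  · exact WeakIdentities.mem_idealI_of_ne hij hf hid
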